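/- Let $F=\mathbb{F}_q$ be a finite field of characteristic $p$, let $G$ be a finite group, and let $\mathbb{F}_qG$ be the group algebra. Ideals are left ideals. A group code is an ideal $C$ of $\mathbb{F}_qG$, regarded, through coordinates with respect to the basis $G$, as a linear code of length $n=|G|$. A non-zero linear code of length $n$, dimension $k$ and minimum Hamming distance $d$ is MDS if $k=n-d+1$; an MDS code is trivial if it is the whole space $\mathbb{F}_q^n$ or is monomially equivalent (equal up to a permutation of the coordinates and multiplication of each coordinate by a non-zero scalar) to the repetition code or to the dual of the repetition code. A group code is ECD if it is generated, as an ideal, by an idempotent and its dimension over $\mathbb{F}_q$ is at most $p$. The algebra $\mathbb{F}_qG$ is an ECD group algebra if every non-zero proper ideal of it is an ECD group code. The MDS conjecture is the assertion that, for all prime powers $q$ and all $n,k$, if there is a non-trivial MDS code of length $n$ and dimension $k$ over $\mathbb{F}_q$, then $n\le q+2$ if $q$ is even and $k\in\{3,q-1\}$, and $n\le q+1$ otherwise. (1) If $C$ is an MDS and ECD group code in $\mathbb{F}_qG$ that is not monomially equivalent to the repetition code (in particular, if $C$ is a non-trivial MDS and ECD group code), then $|G|\le q+1$. (2) Let $p$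 be an odd prime, suppose that the MDS conjecture is true, and let $G$ be a finite group that is not cyclic of order $p$. If there is a non-trivial MDS group code in $\mathbb{F}_pG$, then $\mathbb{F}_pG$ is an ECD group algebra. -/

import Mathlib

namespace GroupCode

section LinearCodes

variable {ι F : Type*} [Fintype ι] [Field F]

open Classical in
/-- The minimum distance of a linear code `C ⊆ F^ι`: the minimum Hamming distance between two
distinct codewords. -/
noncomputable def minDist (C : Submodule F (ι → F)) : ℕ :=
  sInf {d : ℕ | ∃ x ∈ C, ∃ y ∈ C, x ≠ y ∧ hammingDist x y = d}

open Classical in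
/-- The minimum distance of a linear code is the minimum Hamming weight of its non-zero
codewords. -/
theorem minDist_eq_minWeight (C : Submodule F (ι → F)) :
    minDist C = sInf {w : ℕ | ∃ x ∈ C, x ≠ 0 ∧ hammingNorm x = w} := by
  unfold minDist
  congr 1
  ext d
  constructor
  · rintro ⟨x, hx, y, hy, hne, rfl⟩
    exact ⟨-x + y, C.add_mem (C.neg_mem hx) hy, fun h => hne (neg_add_eq_zero.mp h),
      (hammingDist_eq_hammingNorm x y).symm⟩
  · rintro ⟨x, hx, hne, rfl⟩
    exact ⟨x, hx, 0, C.zero_mem, hne, hammingDist_zero_right x⟩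

/-- `C` is a maximum distance separable linear code: `C` is non-zero (so that its minimum distance
`d` exists) and attains the Singleton bound `k = n - d + 1`. -/
def IsMDS (C : Submodule F (ι → F)) : Prop :=
  C ≠ ⊥ ∧ Module.finrank F C + minDist C = Fintype.card ι + 1

/-- `C` and `D` are monomially equivalent: a permutation of the coordinates followed by a rescaling
of each coordinate by a non-zero scalar maps `C` onto `D`. -/
def MonomiallyEquivalent (C D : Submodule F (ι → F)) : Prop :=
  ∃ (σ : Equiv.Perm ι) (a : ι → Fˣ),
    ∀ x : ι → F, x ∈ C ↔ (fun i => (a i : F) * x (σ i)) ∈ D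

variable (ι F) in
/-- The repetition code, spanned by the all-one vector. -/
def repetitionCode : Submodule F (ι → F) :=
  Submodule.span F {fun _ => 1}

/-- The dual code, with respect to the standard bilinear form. -/
def dualCode (C : Submodule F (ι → F)) : Submodule F (ι → F) where
  carrier := {x | ∀ y ∈ C, x ⬝ᵥ y = 0}
  add_mem' := by
    intro x x' hx hx' y hy
    rw [add_dotProduct, hx y hy, hx' y hy, add_zero]
  zero_mem' := fun y _ => zero_dotProduct y
  smul_mem' := by
    intro c x hx y hy
    rw [smul_dotProduct, hx y hy, smul_zero]

/-- The trivial MDS codes: the whole space, and the codes that are monomially equivalent to the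
repetition code or to its dual. -/
def IsTrivialMDS (C : Submodule F (ι → F)) : Prop :=
  C = ⊤ ∨ MonomiallyEquivalent C (repetitionCode ι F) ∨
    MonomiallyEquivalent C (dualCode (repetitionCode ι F))

/-- `C` is a non-trivial MDS code. -/
def IsNontrivialMDS (C : Submodule F (ι → F)) : Prop :=
  IsMDS C ∧ ¬ IsTrivialMDS C

end LinearCodes

/-- The MDS conjecture: if there is a non-trivial `[n, k]` MDS code over the field with `q`
elements, then `n ≤ q + 2` if `q` is even and `k = 3` or `k = q - 1`, and `n ≤ q + 1` otherwise. -/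
def MDSConjecture : Prop :=
  ∀ (K : Type) [Field K] [Fintype K] (n k : ℕ),
    (∃ C : Submodule K (Fin n → K), Module.finrank K C = k ∧ IsNontrivialMDS C) →
      (Even (Fintype.card K) ∧ (k = 3 ∨ k = Fintype.card K - 1) → n ≤ Fintype.card K + 2) ∧
      (¬ (Even (Fintype.card K) ∧ (k = 3 ∨ k = Fintype.card K - 1)) → n ≤ Fintype.card K + 1)

section GroupCodes

variable {F G : Type*} [Field F] [Group G] [Fintype G]

/-- The linear code of length `|G|` given by the coordinate vectors, with respect to the basis `G`,
of the elements of a (left) ideal `C` of the group algebra `FG`. -/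
noncomputable def toLinearCode (C : Ideal (MonoidAlgebra F G)) : Submodule F (G → F) :=
  (C.restrictScalars F).map
    ((MonoidAlgebra.coeffLinearEquiv F).trans
      (Finsupp.linearEquivFunOnFinite F F G)).toLinearMap

/-- Membership in `toLinearCode`, in terms of coefficients. -/
theorem mem_toLinearCode (C : Ideal (MonoidAlgebra F G)) (v : G → F) :
    v ∈ toLinearCode C ↔ ∃ x ∈ C, ∀ g, x.coeff g = v g := by
  constructor
  · rintro ⟨x, hx, rfl⟩
    exact ⟨x, hx, fun g => rfl⟩
  · rintro ⟨x, hx, h⟩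
    exact ⟨x, hx, funext h⟩

/-- An easily computable dimension (ECD) group code: a (left) ideal of `FG` that is generated by an
idempotent and whose dimension over `F` is at most the characteristic of `F`. -/
def IsECDCode (C : Ideal (MonoidAlgebra F G)) : Prop :=
  (∃ e : MonoidAlgebra F G, IsIdempotentElem e ∧ C = Ideal.span {e}) ∧
    Module.finrank F (C.restrictScalars F) ≤ ringChar F

variable (F G) in
/-- `FG` is an ECD group algebra: every non-trivial (non-zero and proper) ideal is an ECD group
code. -/
def IsECDGroupAlgebra : Prop :=
  ∀ J : Ideal (MonoidAlgebra F G), J ≠ ⊥ → J ≠ ⊤ → IsECDCode J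

end GroupCodes

end GroupCode

/-!
The first part is an instance of Ball's theorem: an MDS code of dimension `k` with
`2 ≤ k ≤ p = char F` has length at most `q + 1`. An MDS code of dimension `1` is monomially
equivalent to the repetition code, and the length bound needs from the ECD hypothesis only that
`k ≤ p`.

For Ball's theorem, the columns of a generator matrix form an arc: a family `v : ι → F ^ k` every
`k` members of which are linearly independent. Suppose that there are `q + 2` of them
(`DeterminedByCoordinates.exists_restrict` discards the others), and write `k = m + 2`. If
`2 k ≤ q + 5`, there is a set `E` of `2 m + 1` indices. For `C ⊆ E` with `m + 1` elements put
`w C = ∏_{u ∉ C} Δ(u, C)⁻¹ * ∏_{u ∈ E \ C} Δ(u, C)⁻¹`, where `Δ(u, C)` is the determinant of the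
vectors indexed by `u` and by `C`. There are `q + 1` factors, so that the sign caused by the order
chosen on `C` disappears (`arcWeight_eq`). Every sum of `w (A ∪ {e})` over `e ∈ E \ A`, for a set
`A ⊆ E` with `m` elements, vanishes (`sum_arcWeight_insert_eq_zero`): modulo the span of `A` the
vectors are pairwise independent vectors of a plane, and in an affine coordinate of the projective
line with one of the points of `E \ A` at infinity the claim is the formula of Lagrange for the
leading coefficient of the monic polynomial vanishing at the points that are not in the arc,
evaluated by means of Wilson's theorem (`sum_prod_inv_sub_eq_neg_one`). These relations say that
`w` lies in the kernel of an inclusion matrix which is invertible when `(k - 1)!` is not zero in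
`F`, that is, when `k ≤ p` (`eq_zero_of_forall_sum_insert_eq_zero`). Hence `w = 0`, although each
value of `w` is a product of non-zero factors. If `2 k > q + 5`, the same argument applies to the
dual code, which is again MDS and has dimension `q + 2 - k`.

In the second part, the MDS conjecture for the odd prime `p` gives `|G| ≤ p + 1`. A group of this
size whose order is divisible by `p` is cyclic of order `p`. So the group algebra is semisimple by
Maschke's theorem, every left ideal is generated by an idempotent, and a proper one has dimension
at most `|G| - 1 ≤ p`.
-/

namespace GroupCode

open Finset

/-! ### Inclusion relations between subsets of consecutive sizes -/

section

variable {ι F : Type*} [DecidableEq ι] [Field F]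

/-- Double counting of the pairs `(e, C)` with `e ∈ C \ X` and `X ⊆ C`, weighted by `w C`. -/
theorem card_mul_sum_superset {E : Finset ι} {r : ℕ} (w : Finset ι → F) {X : Finset ι} :
    ((r - X.card : ℕ) : F) * ∑ C ∈ E.powersetCard r with X ⊆ C, w C =
      ∑ e ∈ E \ X, ∑ C ∈ E.powersetCard r with insert e X ⊆ C, w C := by
  have h : ∑ e ∈ E \ X, ∑ C ∈ E.powersetCard r with insert e X ⊆ C, w C =
      ∑ C ∈ E.powersetCard r with X ⊆ C, ∑ e ∈ C \ X, w C := by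
    refine Finset.sum_comm' fun e C => ?_
    simp only [mem_sdiff, mem_filter, mem_powersetCard, insert_subset_iff]
    constructor
    · rintro ⟨⟨-, he⟩, hC, heC, hXC⟩
      exact ⟨⟨heC, he⟩, hC, hXC⟩
    · rintro ⟨⟨heC, he⟩, hC, hXC⟩
      exact ⟨⟨hC.1 heC, he⟩, hC, heC, hXC⟩
  rw [h, Finset.mul_sum]
  refine Finset.sum_congr rfl fun C hC => ?_
  simp only [mem_filter, mem_powersetCard] at hC
  rw [Finset.sum_const, nsmul_eq_mul, card_sdiff_of_subset hC.2, hC.1.2]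

/-- Relations for the sets `A` of size `m` propagate to all smaller sets `X`: by double counting,
the sum over the supersets of `X`, multiplied by `m + 1 - |X| ≤ m + 1`, is a sum of sums over the
supersets of larger sets. -/
theorem sum_superset_eq_zero {E : Finset ι} {m : ℕ} (hm : ((m + 1).factorial : F) ≠ 0)
    (w : Finset ι → F)
    (hw : ∀ A ⊆ E, A.card = m → ∑ e ∈ E \ A, w (insert e A) = 0) :
    ∀ j ≤ m, ∀ X ⊆ E, X.card + j = m →
      ∑ C ∈ E.powersetCard (m + 1) with X ⊆ C, w C = 0 := by
  intro j
  induction j with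
  | zero =>
    intro _ X hX hc
    have h := card_mul_sum_superset (E := E) (r := m + 1) w (X := X)
    rw [show m + 1 - X.card = 1 by lia, Nat.cast_one, one_mul] at h
    rw [h, ← hw X hX (by lia)]
    refine Finset.sum_congr rfl fun e he => ?_
    rw [mem_sdiff] at he
    have hcard : (insert e X).card = m + 1 := by rw [card_insert_of_notMem he.2]; lia
    rw [← Finset.sum_singleton w (insert e X)]
    congr 1
    ext C
    simp only [mem_filter, mem_powersetCard, mem_singleton]
    constructor
    · rintro ⟨⟨-, hC⟩, hs⟩
      exact (eq_of_subset_of_card_le hs (by lia)).symm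
    · rintro rfl
      exact ⟨⟨insert_subset he.1 hX, hcard⟩, subset_rfl⟩
  | succ j ih =>
    intro hj X hX hc
    have h := card_mul_sum_superset (E := E) (r := m + 1) w (X := X)
    rw [Finset.sum_eq_zero (s := E \ X)] at h
    · refine (mul_eq_zero.mp h).resolve_left fun h0 => hm ?_
      obtain ⟨c, hc'⟩ := Nat.dvd_factorial (m := m + 1 - X.card) (n := m + 1) (by lia) (by lia)
      rw [hc', Nat.cast_mul, h0, zero_mul]
    · intro e he
      rw [mem_sdiff] at he
      exact ih (by lia) _ (insert_subset he.1 hX) (by rw [card_insert_of_notMem he.2]; lia)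

/-- Inclusion and exclusion, one element of `Y` at a time. -/
theorem sum_superset_disjoint_eq_zero {E : Finset ι} {m : ℕ} (hm : ((m + 1).factorial : F) ≠ 0)
    (w : Finset ι → F)
    (hw : ∀ A ⊆ E, A.card = m → ∑ e ∈ E \ A, w (insert e A) = 0) (Y : Finset ι) (hY : Y ⊆ E) :
    ∀ X ⊆ E, X.card + Y.card ≤ m →
      ∑ C ∈ E.powersetCard (m + 1) with X ⊆ C ∧ Disjoint Y C, w C = 0 := by
  induction Y using Finset.induction_on with
  | empty =>
    intro X hX hc
    simpa using sum_superset_eq_zero hm w hw (m - X.card) (by lia) X hX (by lia)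
  | insert y Y hy ih =>
    intro X hX hc
    rw [card_insert_of_notMem hy] at hc
    rw [insert_subset_iff] at hY
    have h1 := ih hY.2 X hX (by lia)
    have h2 := ih hY.2 (insert y X) (insert_subset hY.1 hX)
      (by have := card_insert_le y X; lia)
    rw [← Finset.sum_filter_add_sum_filter_not _ (fun C => y ∈ C)] at h1
    rw [Finset.filter_filter, Finset.filter_filter] at h1
    have e1 : (E.powersetCard (m + 1)).filter (fun C => (X ⊆ C ∧ Disjoint Y C) ∧ y ∈ C) =
        (E.powersetCard (m + 1)).filter (fun C => insert y X ⊆ C ∧ Disjoint Y C) := by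
      refine filter_congr fun C _ => ?_
      rw [insert_subset_iff]; tauto
    have e2 : (E.powersetCard (m + 1)).filter (fun C => (X ⊆ C ∧ Disjoint Y C) ∧ ¬ y ∈ C) =
        (E.powersetCard (m + 1)).filter (fun C => X ⊆ C ∧ Disjoint (insert y Y) C) := by
      refine filter_congr fun C _ => ?_
      rw [disjoint_insert_left]; tauto
    rwa [e1, e2, h2, zero_add] at h1

/-- The square inclusion matrix of the `m`-subsets versus the `(m + 1)`-subsets of a set with
`2 m + 1` elements is invertible over a field in which `(m + 1)!` is not zero: the set `C` is the
only `(m + 1)`-subset disjoint from `E \ C`, which has `m` elements. -/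
theorem eq_zero_of_forall_sum_insert_eq_zero {E : Finset ι} {m : ℕ} (hE : E.card = 2 * m + 1)
    (hm : ((m + 1).factorial : F) ≠ 0) (w : Finset ι → F)
    (hw : ∀ A ⊆ E, A.card = m → ∑ e ∈ E \ A, w (insert e A) = 0)
    {C : Finset ι} (hC : C ⊆ E) (hcard : C.card = m + 1) : w C = 0 := by
  have hYc : (E \ C).card = m := by rw [card_sdiff_of_subset hC]; lia
  have h := sum_superset_disjoint_eq_zero hm w hw (E \ C) sdiff_subset ∅ (empty_subset _)
    (by simp [hYc])
  rw [← h, ← Finset.sum_singleton w C]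
  congr 1
  ext D
  simp only [mem_filter, mem_powersetCard, mem_singleton, empty_subset, true_and]
  constructor
  · rintro rfl
    exact ⟨⟨hC, hcard⟩, sdiff_disjoint⟩
  · rintro ⟨⟨hD, hDc⟩, hd⟩
    refine eq_of_subset_of_card_le (fun x hx => ?_) (by lia)
    by_contra hxC
    exact disjoint_left.mp hd (mem_sdiff.mpr ⟨hD hx, hxC⟩) hx

end

/-! ### An identity on the affine line over a finite field -/

section

variable {F : Type*} [Field F] [Fintype F] [DecidableEq F]

/-- Wilson's theorem for a finite field, translated by `e`. -/
theorem prod_erase_sub_eq_neg_one (e : F) : ∏ x ∈ univ.erase e, (e - x) = -1 := by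
  have h : ∏ u : Fˣ, (u : F) = -1 := by
    rw [← Units.coe_prod, FiniteField.prod_univ_units_id_eq_neg_one, Units.val_neg, Units.val_one]
  rw [← h]
  symm
  refine Finset.prod_bij (fun u _ => e - u) (fun u _ => by simp) (fun u _ u' _ huu => ?_)
    (fun x hx => ?_) (fun u _ => by ring)
  · exact Units.ext (sub_right_injective huu)
  · refine ⟨Units.mk0 (e - x) (sub_ne_zero.mpr (ne_of_mem_erase hx).symm), mem_univ _, ?_⟩
    simp

/-- The monic polynomial `f` with simple zeros at the points outside `S` has degree `|E| - 1`, so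
Lagrange interpolation at `E` expresses its leading coefficient `1` through its values at the points
`e` of `E`; Wilson's theorem gives `f(e) = -∏ (e - u)⁻¹`, the product being over `u ∈ S \ {e}`. -/
theorem sum_prod_inv_sub_eq_neg_one {S E : Finset F} (hES : E ⊆ S)
    (hcard : S.card + E.card = Fintype.card F + 1) :
    ∑ e ∈ E, (∏ u ∈ S.erase e, (e - u)⁻¹) * ∏ u ∈ E.erase e, (e - u)⁻¹ = -1 := by
  have hS : S.card ≤ Fintype.card F := S.card_le_univ
  have hc : (univ \ S).card + 1 = E.card := by
    rw [← compl_eq_univ_sdiff, card_compl]; lia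
  have h := Lagrange.leadingCoeff_eq_sum (s := E) (v := (id : F → F)) Function.injective_id.injOn
    (P := Lagrange.nodal (univ \ S) (id : F → F))
    (by rw [Lagrange.degree_nodal]; exact_mod_cast hc.symm)
  rw [Lagrange.nodal_monic.leadingCoeff] at h
  rw [h, ← Finset.sum_neg_distrib]
  refine Finset.sum_congr rfl fun e he => ?_
  have h1 : ((∏ u ∈ univ \ S, (e - u)) * ∏ u ∈ S.erase e, (e - u)) = -1 := by
    rw [← prod_erase_sub_eq_neg_one e, ← prod_union]
    · congr 1
      ext x
      have := hES he
      simp only [mem_union, mem_sdiff, mem_univ, mem_erase, true_and, and_true]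
      constructor
      · rintro (hx | hx)
        · rintro rfl; exact hx this
        · exact hx.1
      · intro hx
        by_cases hxS : x ∈ S <;> tauto
    · rw [disjoint_left]
      intro x hx hx'
      exact (mem_sdiff.mp hx).2 (mem_erase.mp hx').2
  have h2 : ∏ u ∈ S.erase e, (e - u) ≠ 0 := fun h0 => by simp [h0] at h1
  simp only [Lagrange.eval_nodal, id, prod_inv_distrib, div_eq_mul_inv]
  rw [← neg_mul]
  congr 1
  field_simp
  rw [mul_comm, h1, neg_neg]

end

/-! ### The identity on the projective line -/

section

variable {ι F : Type*} [DecidableEq ι] [Field F]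

/-- The product at `e` in the affine coordinate `b / c`, which is infinite at `e₀`. -/
theorem prod_erase_inv_line {b c : ι → F} {e₀ e : ι} (hc₀ : c e₀ = 0) {T : Finset ι}
    (hce : c e ≠ 0) (hc : ∀ u ∈ T.erase e₀, c u ≠ 0) (h₀ : e₀ ∈ T) (he : e ∈ T.erase e₀) :
    ∏ u ∈ T.erase e, (b e * c u - c e * b u)⁻¹ =
      -((b e₀)⁻¹ * (c e)⁻¹ ^ ((T.erase e₀).card - 1) * (∏ u ∈ T.erase e₀, (c u)⁻¹) *
        ∏ u ∈ (T.erase e₀).erase e, (b e / c e - b u / c u)⁻¹) := by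
  have hne : e₀ ≠ e := (ne_of_mem_erase he).symm
  rw [← mul_prod_erase (T.erase e) _ (mem_erase.mpr ⟨hne, h₀⟩), erase_right_comm,
    ← mul_prod_erase (T.erase e₀) _ he, ← card_erase_of_mem he]
  have h : ∏ u ∈ (T.erase e₀).erase e, (b e * c u - c e * b u)⁻¹ =
      ∏ u ∈ (T.erase e₀).erase e, ((c e)⁻¹ * ((c u)⁻¹ * (b e / c e - b u / c u)⁻¹)) := by
    refine Finset.prod_congr rfl fun u hu => ?_
    have := hc u (mem_of_mem_erase hu)
    rw [← mul_inv, ← mul_inv]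
    congr 1
    field_simp
  rw [h, prod_mul_distrib, prod_mul_distrib, prod_const, hc₀, mul_zero, zero_sub, inv_neg, mul_inv]
  ring

variable [Fintype F]

/-- The projective identity for pairwise independent vectors `(b e, c e)` of the plane, one of
which, with index in `E`, lies on the line `c = 0`. Its term and the other ones, which form the
affine identity, cancel. -/
theorem sum_prod_inv_line_eq_zero_of_zero {S E : Finset ι} (hES : E ⊆ S)
    (hcard : S.card + E.card = Fintype.card F + 3) {b c : ι → F}
    (hD : ∀ e ∈ S, ∀ u ∈ S, e ≠ u → b e * c u - c e * b u ≠ 0) {e₀ : ι} (h₀ : e₀ ∈ E)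
    (hc₀ : c e₀ = 0) :
    ∑ e ∈ E, (∏ u ∈ S.erase e, (b e * c u - c e * b u)⁻¹) *
      ∏ u ∈ E.erase e, (b e * c u - c e * b u)⁻¹ = 0 := by
  classical
  have hcS : ∀ u ∈ S.erase e₀, b e₀ ≠ 0 ∧ c u ≠ 0 := fun u hu => by
    have h := hD e₀ (hES h₀) u (mem_of_mem_erase hu) (ne_of_mem_erase hu).symm
    rw [hc₀, zero_mul, sub_zero] at h
    exact ⟨left_ne_zero_of_mul h, right_ne_zero_of_mul h⟩
  have hES' : E.erase e₀ ⊆ S.erase e₀ := erase_subset_erase _ hES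
  have hEc := card_erase_add_one h₀
  have hSc := card_erase_add_one (hES h₀)
  have hle := card_le_card hES
  have hSpos : 0 < Fintype.card F := Fintype.card_pos
  have hb : b e₀ ≠ 0 := by
    obtain ⟨u, hu⟩ : (S.erase e₀).Nonempty := by rw [← card_pos]; lia
    exact (hcS u hu).1
  set φ : ι → F := fun u => b u / c u with hφ
  have hinj : Set.InjOn φ (S.erase e₀ : Finset ι) := by
    intro e he u hu heu
    by_contra hne
    have h1 := (hcS e he).2
    have h2 := (hcS u hu).2
    refine hD e (mem_of_mem_erase he) u (mem_of_mem_erase hu) hne ?_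
    simp only [hφ] at heu
    field_simp at heu
    linear_combination heu
  -- in the affine coordinate `φ`, with `e₀` at infinity
  have haff := sum_prod_inv_sub_eq_neg_one (image_subset_image (f := φ) hES')
    (by
      rw [card_image_of_injOn hinj, card_image_of_injOn (hinj.mono (by exact_mod_cast hES'))]
      lia)
  have himg : ∀ T ⊆ S.erase e₀, ∀ e ∈ T, ∏ u ∈ (T.image φ).erase (φ e), (φ e - u)⁻¹ =
      ∏ u ∈ T.erase e, (φ e - φ u)⁻¹ := by
    intro T hT e he
    rw [← prod_image (g := φ) (f := fun x => (φ e - x)⁻¹)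
      (hinj.mono (by exact_mod_cast (erase_subset _ _).trans hT))]
    congr 1
    ext x
    simp only [mem_erase, mem_image]
    constructor
    · rintro ⟨hx, u, hu, rfl⟩
      exact ⟨u, ⟨fun h => hx (h ▸ rfl), hu⟩, rfl⟩
    · rintro ⟨u, ⟨hne, hu⟩, rfl⟩
      exact ⟨fun h => hne (hinj (hT hu) (hT he) h), u, hu, rfl⟩
  rw [sum_image (hinj.mono (by exact_mod_cast hES'))] at haff
  have haff' : ∑ e ∈ E.erase e₀, (∏ u ∈ (S.erase e₀).erase e, (φ e - φ u)⁻¹) *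
      ∏ u ∈ (E.erase e₀).erase e, (φ e - φ u)⁻¹ = -1 := by
    rw [← haff]
    refine Finset.sum_congr rfl fun e he => ?_
    rw [himg _ subset_rfl e (hES' he), himg _ hES' e he]
  set K : F := (b e₀)⁻¹ ^ 2 * ((∏ u ∈ S.erase e₀, (c u)⁻¹) * ∏ u ∈ E.erase e₀, (c u)⁻¹) with hK
  have hpow : ∀ x : F, x ≠ 0 → x ^ ((S.erase e₀).card - 1) * x ^ ((E.erase e₀).card - 1) = 1 := by
    intro x hx
    have hE2 : 0 < (E.erase e₀).card := by
      have : (S.erase e₀).card ≤ Fintype.card F := by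
        rw [← card_image_of_injOn hinj]; exact card_le_univ _
      lia
    rw [← pow_add, show (S.erase e₀).card - 1 + ((E.erase e₀).card - 1) = Fintype.card F - 1 by
      have := card_le_card hES'; lia]
    exact FiniteField.pow_card_sub_one_eq_one x hx
  rw [← add_sum_erase E _ h₀]
  have hterm0 : (∏ u ∈ S.erase e₀, (b e₀ * c u - c e₀ * b u)⁻¹) *
      ∏ u ∈ E.erase e₀, (b e₀ * c u - c e₀ * b u)⁻¹ = K := by
    simp only [hc₀, zero_mul, sub_zero, mul_inv, prod_mul_distrib, prod_const]
    have h2 : (b e₀)⁻¹ ^ (S.erase e₀).card * (b e₀)⁻¹ ^ (E.erase e₀).card = (b e₀)⁻¹ ^ 2 := by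
      rw [← pow_add, show (S.erase e₀).card + (E.erase e₀).card = Fintype.card F + 1 by lia,
        pow_succ, FiniteField.pow_card, pow_two]
    rw [hK, ← h2]; ring
  have hterm : ∀ e ∈ E.erase e₀, (∏ u ∈ S.erase e, (b e * c u - c e * b u)⁻¹) *
      ∏ u ∈ E.erase e, (b e * c u - c e * b u)⁻¹ =
      K * ((∏ u ∈ (S.erase e₀).erase e, (φ e - φ u)⁻¹) *
      ∏ u ∈ (E.erase e₀).erase e, (φ e - φ u)⁻¹) := by
    intro e he
    have hce := (hcS e (hES' he)).2
    rw [prod_erase_inv_line hc₀ hce (fun u hu => (hcS u hu).2) (hES h₀) (hES' he),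
      prod_erase_inv_line hc₀ hce (fun u hu => (hcS u (hES' hu)).2) h₀ he, hK]
    linear_combination ((b e₀)⁻¹ ^ 2 * ((∏ u ∈ S.erase e₀, (c u)⁻¹) * ∏ u ∈ E.erase e₀, (c u)⁻¹) *
      ((∏ u ∈ (S.erase e₀).erase e, (φ e - φ u)⁻¹) *
      ∏ u ∈ (E.erase e₀).erase e, (φ e - φ u)⁻¹)) * hpow (c e)⁻¹ (inv_ne_zero hce)
  rw [hterm0, sum_congr rfl hterm, ← mul_sum, haff']
  ring

/-- The projective identity for an abstract alternating pairing `D` satisfying the Plücker relation.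
The relation provides plane coordinates in which `D` is the determinant and a given point lies on
the line `c = 0`. -/
theorem sum_prod_inv_line_eq_zero {S E : Finset ι} (hES : E ⊆ S)
    (hcard : S.card + E.card = Fintype.card F + 3) (D : ι → ι → F) (hD0 : ∀ e, D e e = 0)
    (hD : ∀ e ∈ S, ∀ u ∈ S, e ≠ u → D e u ≠ 0)
    (hpl : ∀ e ∈ S, ∀ u ∈ S, ∀ x ∈ S, ∀ y ∈ S, x ≠ y →
      D e u * D x y = D e y * D x u - D x e * D u y) (hE : E.Nonempty) :
    ∑ e ∈ E, (∏ u ∈ S.erase e, (D e u)⁻¹) * ∏ u ∈ E.erase e, (D e u)⁻¹ = 0 := by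
  obtain ⟨x, hx⟩ := hE
  have hle := card_le_card hES
  have hpos : 0 < Fintype.card F := Fintype.card_pos
  obtain ⟨y, hy, hxy⟩ : ∃ y ∈ S, y ≠ x := Finset.exists_mem_ne (by lia) x
  have hDxy := hD x (hES hx) y hy hxy.symm
  have key : ∀ e ∈ S, ∀ u ∈ S, D e y / D x y * D x u - D x e * (D u y / D x y) = D e u := by
    intro e he u hu
    have := hpl e he u hu x (hES hx) y hy hxy.symm
    field_simp
    linear_combination -this
  have h := sum_prod_inv_line_eq_zero_of_zero hES hcard (b := fun e => D e y / D x y)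
    (c := fun u => D x u) (fun e he u hu hne => by rw [key e he u hu]; exact hD e he u hu hne)
    hx (hD0 x)
  rw [← h]
  refine Finset.sum_congr rfl fun e he => ?_
  congr 1
  · exact Finset.prod_congr rfl fun u hu => by rw [key e (hES he) u (mem_of_mem_erase hu)]
  · exact Finset.prod_congr rfl fun u hu => by
      rw [key e (hES he) u (hES (mem_of_mem_erase hu))]

end

/-! ### The Plücker relation for determinants -/

section

variable {F V : Type*} [Field F] [AddCommGroup V] [Module F V]

open Matrix

/-- The three-term Plücker relation for a form of top degree. Only the case in which `z, w, a` is a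
basis is treated. -/
theorem alternating_plucker {m : ℕ} (Δ : V [⋀^Fin (m + 2)]→ₗ[F] F)
    [FiniteDimensional F V] (hV : Module.finrank F V = m + 2) (a : Fin m → V) {z w : V}
    (hzw : Δ (vecCons z (vecCons w a)) ≠ 0) (x y : V) :
    Δ (vecCons x (vecCons y a)) * Δ (vecCons z (vecCons w a)) =
      Δ (vecCons x (vecCons w a)) * Δ (vecCons z (vecCons y a)) -
        Δ (vecCons z (vecCons x a)) * Δ (vecCons y (vecCons w a)) := by
  have hind : LinearIndependent F (vecCons z (vecCons w a)) := by
    by_contra h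
    exact hzw (Δ.map_linearDependent _ h)
  have hspan : Submodule.span F (Set.range (vecCons z (vecCons w a))) = ⊤ :=
    hind.span_eq_top_of_card_eq_finrank' (by simp [hV])
  have hswap : ∀ p r : V, Δ (vecCons p (vecCons r a)) = -Δ (vecCons r (vecCons p a)) := by
    intro p r
    have h := Δ.map_swap (vecCons p (vecCons r a)) (i := 0) (j := 1) (by simp)
    rw [← neg_eq_iff_eq_neg.mpr h]
    congr 2
    funext i
    refine Fin.cases ?_ (fun i => Fin.cases ?_ (fun i => ?_) i) i
    · simp
    · simp
    · have h0 : (i.succ.succ : Fin (m + 2)) ≠ 0 := Fin.succ_ne_zero _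
      have h1 : (i.succ.succ : Fin (m + 2)) ≠ 1 := by
        intro h; exact Fin.succ_ne_zero i (Fin.succ_injective _ h)
      simp [Equiv.swap_apply_of_ne_of_ne h0 h1]
  have hself : ∀ p : V, Δ (vecCons p (vecCons p a)) = 0 := fun p =>
    Δ.map_eq_zero_of_eq _ (i := 0) (j := 1) (by simp) (by simp)
  have ha : ∀ (p : V) (i : Fin m), Δ (vecCons (a i) (vecCons p a)) = 0 := fun p i =>
    Δ.map_eq_zero_of_eq _ (i := 0) (j := i.succ.succ) (by simp) (Fin.succ_ne_zero _).symm
  rw [hswap z x]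
  -- both sides are linear in `x`, and agree on the basis `z, w, a`
  have hx : x ∈ Submodule.span F (Set.range (vecCons z (vecCons w a))) := by
    rw [hspan]; trivial
  induction hx using Submodule.span_induction with
  | mem x hx =>
    obtain ⟨i, rfl⟩ := hx
    refine Fin.cases ?_ (fun i => Fin.cases ?_ (fun i => ?_) i) i
    · simp only [cons_val_zero, hself]; ring
    · simp only [cons_val_succ, cons_val_zero, hself, hswap w z, hswap w y]; ring
    · simp only [cons_val_succ, ha]; ring
  | zero =>
    have h : ∀ b : Fin (m + 1) → V, Δ (vecCons 0 b) = 0 := fun b =>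
      Δ.map_coord_zero (i := 0) rfl
    simp only [h]; ring
  | add x x' _ _ h h' =>
    simp only [Δ.map_vecCons_add]
    linear_combination h + h'
  | smul r x _ h =>
    simp only [Δ.map_vecCons_smul, smul_eq_mul]
    linear_combination r * h

end

/-! ### Arcs with `q + 2` vectors -/

section

open Matrix

theorem vecCons_injective {ι : Type*} {n : ℕ} {e : ι} {a : Fin n → ι} (ha : Function.Injective a)
    (he : e ∉ Set.range a) : Function.Injective (vecCons e a) :=
  Fin.cons_injective_iff.mpr ⟨he, ha⟩

variable {ι F V : Type*} [DecidableEq ι] [Field F] [AddCommGroup V] [Module F V]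
  {m : ℕ}

theorem exists_enumeration {n : ℕ} {A : Finset ι} (hA : A.card = n) :
    ∃ a : Fin n → ι, Function.Injective a ∧ univ.image a = A := by
  refine ⟨fun i => (A.equivFinOfCardEq hA).symm i,
    Subtype.val_injective.comp (Equiv.injective _), ?_⟩
  ext x
  simp only [mem_image, mem_univ, true_and]
  constructor
  · rintro ⟨i, rfl⟩; exact ((A.equivFinOfCardEq hA).symm i).2
  · intro hx; exact ⟨A.equivFinOfCardEq hA ⟨x, hx⟩, by simp⟩

theorem exists_perm_of_image_eq {n : ℕ} {g g' : Fin n → ι}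
    (hg' : Function.Injective g') (h : univ.image g = univ.image g') :
    ∃ σ : Equiv.Perm (Fin n), g' = g ∘ σ := by
  have hex : ∀ i, ∃ j, g j = g' i := fun i => by
    have : g' i ∈ univ.image g := h ▸ mem_image_of_mem _ (mem_univ i)
    simpa using this
  choose σ hσ using hex
  have hinj : Function.Injective σ := fun i j hij => hg' (by rw [← hσ i, ← hσ j, hij])
  exact ⟨Equiv.ofBijective σ (Finite.injective_iff_bijective.mp hinj), funext fun i => (hσ i).symm⟩

variable [Fintype ι]

/-- The weight of the set `C` enumerated by `g`: the product of the inverses of the determinants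
`Δ(v u, v ∘ g)` over all `u ∉ C`, where those with `u ∈ E` are counted twice. -/
def enumWeight (Δ : V [⋀^Fin (m + 2)]→ₗ[F] F) (v : ι → V) (E C : Finset ι)
    (g : Fin (m + 1) → ι) : F :=
  (∏ u ∈ Cᶜ, (Δ (vecCons (v u) (v ∘ g)))⁻¹) * ∏ u ∈ E \ C, (Δ (vecCons (v u) (v ∘ g)))⁻¹

open Classical in
/-- The weight of a set `C` with `m + 1` elements, computed from an arbitrary enumeration of `C`; it
is `0` for sets of another size. -/
noncomputable def arcWeight (Δ : V [⋀^Fin (m + 2)]→ₗ[F] F) (v : ι → V) (E C : Finset ι) : F :=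
  if h : ∃ g : Fin (m + 1) → ι, Function.Injective g ∧ univ.image g = C then
    enumWeight Δ v E C h.choose
  else 0

variable [Fintype F]

/-- For `q + 2` vectors the weight of a set does not depend on the enumeration, since it has `q + 1`
factors and `s ^ (q + 1) = s ^ 2 = 1` in `F` for a sign `s`. -/
theorem arcWeight_eq (hι : Fintype.card ι = Fintype.card F + 2)
    (Δ : V [⋀^Fin (m + 2)]→ₗ[F] F) (v : ι → V) {E C : Finset ι}
    (hE : E.card = 2 * m + 1) (hC : C ⊆ E) {g : Fin (m + 1) → ι} (hg : Function.Injective g)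
    (hgC : univ.image g = C) : arcWeight Δ v E C = enumWeight Δ v E C g := by
  have hex : ∃ g : Fin (m + 1) → ι, Function.Injective g ∧ univ.image g = C := ⟨g, hg, hgC⟩
  rw [arcWeight, dif_pos hex]
  obtain ⟨σ, hσ⟩ := exists_perm_of_image_eq hex.choose_spec.1
    (hgC.trans hex.choose_spec.2.symm)
  have hCc : C.card = m + 1 := by
    rw [← hgC, card_image_of_injective _ hg, card_univ, Fintype.card_fin]
  have hΔ : ∀ u, Δ (vecCons (v u) (v ∘ hex.choose)) =
      ((Equiv.Perm.sign σ : ℤ) : F) * Δ (vecCons (v u) (v ∘ g)) := by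
    intro u
    rw [hσ, ← Function.comp_assoc]
    have h := (Δ.curryLeft (v u)).map_perm (v ∘ g) σ
    simp only [AlternatingMap.curryLeft_apply_apply] at h
    rw [h, Units.smul_def, zsmul_eq_mul]
  set s : F := ((Equiv.Perm.sign σ : ℤ) : F) with hs
  have hss : s * s = 1 := by
    rw [hs, ← Int.cast_mul, Int.units_coe_mul_self, Int.cast_one]
  have hsinv : s⁻¹ = s := inv_eq_of_mul_eq_one_left hss
  have hcard : Cᶜ.card + (E \ C).card = Fintype.card F + 1 := by
    have h1 := card_le_card hC
    have h2 := E.card_le_univ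
    rw [card_compl, card_sdiff_of_subset hC]; lia
  -- an odd permutation changes the sign of each of the `q + 1` factors
  have hpow : s ^ Cᶜ.card * s ^ (E \ C).card = 1 := by
    rw [← pow_add, hcard, pow_succ, FiniteField.pow_card, hss]
  simp only [enumWeight, hΔ, mul_inv, prod_mul_distrib, prod_const, hsinv]
  linear_combination ((∏ u ∈ Cᶜ, (Δ (vecCons (v u) (v ∘ g)))⁻¹) *
    ∏ u ∈ E \ C, (Δ (vecCons (v u) (v ∘ g)))⁻¹) * hpow

/-- The relation between the weights of the sets `A ∪ {e}`, where `A ⊆ E` has `m` elements. It is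
the projective identity for the pairing `(e, u) ↦ Δ(u, e, A)`, the points being the indices outside
`A`. -/
theorem sum_arcWeight_insert_eq_zero [FiniteDimensional F V]
    (hV : Module.finrank F V = m + 2) (hι : Fintype.card ι = Fintype.card F + 2)
    (Δ : V [⋀^Fin (m + 2)]→ₗ[F] F) (v : ι → V)
    (hΔ : ∀ g : Fin (m + 2) → ι, Function.Injective g → Δ (v ∘ g) ≠ 0) {E A : Finset ι}
    (hE : E.card = 2 * m + 1) (hA : A ⊆ E) (hAc : A.card = m) :
    ∑ e ∈ E \ A, arcWeight Δ v E (insert e A) = 0 := by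
  obtain ⟨a, ha, haA⟩ := exists_enumeration hAc
  have hmem : ∀ x, x ∉ A → x ∉ Set.range a := by
    rintro x hx ⟨i, rfl⟩
    exact hx (haA ▸ mem_image_of_mem _ (mem_univ i))
  have hcomp : ∀ {n : ℕ} (e : ι) (b : Fin n → ι), vecCons (v e) (v ∘ b) = v ∘ vecCons e b :=
    fun e b => (Fin.comp_cons v e b).symm
  set D : ι → ι → F := fun e u => Δ (vecCons (v u) (vecCons (v e) (v ∘ a))) with hDdef
  have hD : ∀ e ∈ Aᶜ, ∀ u ∈ Aᶜ, e ≠ u → D e u ≠ 0 := by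
    intro e he u hu hne
    simp only [hDdef, hcomp]
    refine hΔ _ (vecCons_injective (vecCons_injective ha (hmem e (mem_compl.mp he))) ?_)
    rintro ⟨i, hi⟩
    revert hi
    refine Fin.cases (fun hi => hne hi) (fun i hi => ?_) i
    exact hmem u (mem_compl.mp hu) ⟨i, hi⟩
  have hle := E.card_le_univ
  have h := sum_prod_inv_line_eq_zero (S := Aᶜ) (E := E \ A)
    (fun x hx => mem_compl.mpr (mem_sdiff.mp hx).2)
    (by rw [card_compl, card_sdiff_of_subset hA]; lia) D
    (fun e => Δ.map_eq_zero_of_eq _ (i := 0) (j := 1) (by simp) (by simp)) hD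
    (fun e he u hu x hx y hy hxy =>
      alternating_plucker Δ hV (v ∘ a) (hD x hx y hy hxy) (v u) (v e) |>.trans (by
        simp only [hDdef]; ring))
    (by rw [← card_pos, card_sdiff_of_subset hA]; lia)
  rw [← h]
  refine Finset.sum_congr rfl fun e he => ?_
  have he' := mem_sdiff.mp he
  rw [arcWeight_eq hι Δ v hE (insert_subset he'.1 hA)
    (vecCons_injective ha (hmem e he'.2)) ?_]
  · simp only [enumWeight, hDdef, ← hcomp]
    congr 2
    · ext x; simp only [mem_compl, mem_insert, mem_erase]; tauto
    · ext x; simp only [mem_sdiff, mem_insert, mem_erase]; tauto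
  · ext x
    rw [← haA]
    simp [Fin.exists_fin_succ, eq_comm]

/-- A space of dimension `m + 2` over the field with `q` elements contains no arc of `q + 2`
vectors, if `(m + 1)!` is not zero in the field and `2 m + 1 ≤ q + 2`. -/
theorem not_exists_arc [FiniteDimensional F V]
    (hV : Module.finrank F V = m + 2) (hι : Fintype.card ι = Fintype.card F + 2)
    (hm : 2 * m + 1 ≤ Fintype.card ι) (hfac : ((m + 1).factorial : F) ≠ 0)
    (Δ : V [⋀^Fin (m + 2)]→ₗ[F] F) (v : ι → V) :
    ¬ ∀ g : Fin (m + 2) → ι, Function.Injective g → Δ (v ∘ g) ≠ 0 := by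
  intro hΔ
  obtain ⟨E, -, hE⟩ := exists_subset_card_eq (s := (univ : Finset ι)) (n := 2 * m + 1) (by simpa)
  obtain ⟨C, hC, hCc⟩ := exists_subset_card_eq (s := E) (n := m + 1) (by lia)
  have h0 := eq_zero_of_forall_sum_insert_eq_zero hE hfac (arcWeight Δ v E)
    (fun A hA hAc => sum_arcWeight_insert_eq_zero hV hι Δ v hΔ hE hA hAc) hC hCc
  obtain ⟨g, hg, hgC⟩ := exists_enumeration hCc
  rw [arcWeight_eq hι Δ v hE hC hg hgC, enumWeight] at h0
  have hne : ∀ u ∉ C, Δ (vecCons (v u) (v ∘ g)) ≠ 0 := by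
    intro u hu
    rw [← show v ∘ vecCons u g = vecCons (v u) (v ∘ g) from Fin.comp_cons v u g]
    refine hΔ _ (vecCons_injective hg ?_)
    rintro ⟨i, rfl⟩
    exact hu (hgC ▸ mem_image_of_mem _ (mem_univ i))
  exact mul_ne_zero (prod_ne_zero_iff.mpr fun u hu => inv_ne_zero (hne u (mem_compl.mp hu)))
    (prod_ne_zero_iff.mpr fun u hu => inv_ne_zero (hne u (mem_sdiff.mp hu).2)) h0

end

/-! ### The length of MDS codes of small dimension -/

section

variable {ι F : Type*} [Field F]

/-- A codeword of `C` is determined by its values at any `dim C` coordinates, that is, every set of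
`dim C` coordinates is an information set. For a non-zero code this is the MDS property. -/
def DeterminedByCoordinates (C : Submodule F (ι → F)) : Prop :=
  ∀ B : Finset ι, B.card = Module.finrank F C → ∀ x ∈ C, (∀ i ∈ B, x i = 0) → x = 0

/-- Puncturing: the restriction of the code to at least `dim C` coordinates. -/
theorem DeterminedByCoordinates.exists_restrict {C : Submodule F (ι → F)}
    (hC : DeterminedByCoordinates C) (T : Finset ι) (hT : Module.finrank F C ≤ T.card) :
    ∃ C' : Submodule F (T → F), Module.finrank F C' = Module.finrank F C ∧
      DeterminedByCoordinates C' := by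
  have hzero : ∀ B ⊆ T, B.card = Module.finrank F C → ∀ x ∈ C,
      (∀ i : T, (i : ι) ∈ B → x i = 0) → x = 0 :=
    fun B hB hBc x hx h => hC B hBc x hx fun i hi => h ⟨i, hB hi⟩ hi
  obtain ⟨B₀, hB₀, hB₀c⟩ := exists_subset_card_eq hT
  let r : C →ₗ[F] (T → F) := (LinearMap.funLeft F F (Subtype.val : T → ι)).comp C.subtype
  have hr : Function.Injective r := by
    rw [injective_iff_map_eq_zero]
    intro x hx
    exact Subtype.ext (hzero B₀ hB₀ hB₀c x x.2 fun i _ => congr_fun hx i)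
  have hfin : Module.finrank F (LinearMap.range r) = Module.finrank F C :=
    LinearMap.finrank_range_of_inj hr
  refine ⟨LinearMap.range r, hfin, ?_⟩
  intro B hBc x hx hxB
  obtain ⟨y, rfl⟩ := hx
  have hy : y = 0 := Subtype.ext (hzero (B.map (Function.Embedding.subtype _))
    (fun i hi => by
      obtain ⟨j, -, rfl⟩ := mem_map.mp hi
      exact j.2) (by rw [card_map, hBc, hfin]) y y.2 (fun i hi => hxB i (by simpa using hi)))
  rw [hy, map_zero]

/-- The columns of a generator matrix form an arc. -/
theorem DeterminedByCoordinates.det_ne_zero {C : Submodule F (ι → F)}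
    (hC : DeterminedByCoordinates C) {k : ℕ} (b : Module.Basis (Fin k) F C) (g : Fin k → ι)
    (hg : Function.Injective g) :
    Matrix.detRowAlternating ((fun i j => (b j : ι → F) i) ∘ g) ≠ (0 : F) := by
  classical
  intro h
  obtain ⟨x, hx, hx0⟩ := Matrix.exists_mulVec_eq_zero_iff.mpr
    (show Matrix.det (fun r j => (b j : ι → F) (g r)) = 0 from h)
  refine hx ?_
  have hk : Module.finrank F C = k := by rw [Module.finrank_eq_card_basis b, Fintype.card_fin]
  have hz : (∑ j, x j • b j : C) = 0 := by
    refine Subtype.ext (hC (univ.image g) (by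
      rw [card_image_of_injective _ hg, card_univ, Fintype.card_fin, hk]) _
      (Subtype.prop _) fun i hi => ?_)
    obtain ⟨r, -, rfl⟩ := mem_image.mp hi
    have := congr_fun hx0 r
    simpa [Matrix.mulVec, dotProduct, mul_comm] using this
  funext j
  exact Fintype.linearIndependent_iff.mp b.linearIndependent x hz j

variable [Fintype ι]

theorem minDist_le_hammingNorm [DecidableEq F] {C : Submodule F (ι → F)} {x : ι → F} (hx : x ∈ C)
    (h0 : x ≠ 0) : minDist C ≤ hammingNorm x := by
  rw [minDist_eq_minWeight]
  exact Nat.sInf_le ⟨x, hx, h0, by congr!⟩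

/-- A non-zero codeword has weight at least `n - k + 1`, so it has fewer than `k` zeros. -/
theorem IsMDS.determinedByCoordinates {C : Submodule F (ι → F)} (hC : IsMDS C) :
    DeterminedByCoordinates C := by
  classical
  intro B hB x hx hxB
  by_contra h0
  have h1 := minDist_le_hammingNorm hx h0
  have h2 : hammingNorm x ≤ Bᶜ.card := by
    refine card_le_card fun i hi => ?_
    rw [mem_compl]
    exact fun hiB => (mem_filter.mp hi).2 (hxB i hiB)
  have h3 := B.card_le_univ
  have h4 := hC.2
  rw [card_compl] at h2
  lia

theorem finrank_dualCode (C : Submodule F (ι → F)) :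
    Module.finrank F C + Module.finrank F (dualCode C) = Fintype.card ι := by
  classical
  have h : dualCode C = C.dualAnnihilator.map (dotProductEquiv F ι).symm.toLinearMap := by
    rw [← Submodule.comap_equiv_eq_map_symm]
    ext x
    rw [Submodule.mem_comap, Submodule.mem_dualAnnihilator]
    rfl
  rw [h, LinearEquiv.finrank_map_eq, Subspace.finrank_add_finrank_dualAnnihilator_eq,
    Module.finrank_fintype_fun_eq_card]

/-- Complements of information sets are information sets of the dual: the values of a codeword of
`C` outside `B` can be prescribed, so a dual codeword that vanishes on `B` is orthogonal to a codeword
that picks out any one of its other coordinates. -/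
theorem DeterminedByCoordinates.dualCode {C : Submodule F (ι → F)}
    (hC : DeterminedByCoordinates C) : DeterminedByCoordinates (dualCode C) := by
  classical
  intro B hB y hy hyB
  have hdim := finrank_dualCode C
  have hle := B.card_le_univ
  have hBc : Bᶜ.card = Module.finrank F C := by rw [card_compl]; lia
  let r : C →ₗ[F] ((Bᶜ : Finset ι) → F) :=
    (LinearMap.funLeft F F (Subtype.val : (Bᶜ : Finset ι) → ι)).comp C.subtype
  have hr : Function.Injective r := by
    rw [injective_iff_map_eq_zero]
    intro x hx
    exact Subtype.ext (hC Bᶜ hBc x x.2 fun i hi => congr_fun hx ⟨i, hi⟩)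
  have hs : Function.Surjective r :=
    (LinearMap.injective_iff_surjective_of_finrank_eq_finrank 
      (by rw [Module.finrank_fintype_fun_eq_card, Fintype.card_coe, hBc])).mp hr
  funext i
  by_cases hi : i ∈ B
  · exact hyB i hi
  obtain ⟨x, hx⟩ := hs (Pi.single ⟨i, mem_compl.mpr hi⟩ 1)
  -- `x` is a codeword of `C` whose only coordinate outside `B` that is not zero is the one at `i`
  have h := hy x x.2
  rw [dotProduct, Finset.sum_eq_single i] at h
  · have hxi : (x : ι → F) i = 1 := by
      have := congr_fun hx ⟨i, mem_compl.mpr hi⟩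
      simpa [r] using this
    rwa [hxi, mul_one] at h
  · intro j _ hji
    by_cases hj : j ∈ B
    · rw [hyB j hj, zero_mul]
    · have : (x : ι → F) j = 0 := by
        have := congr_fun hx ⟨j, mem_compl.mpr hj⟩
        rwa [Pi.single_eq_of_ne (by simpa [Subtype.ext_iff] using hji)] at this
      rw [this, mul_zero]
  · simp

variable [Fintype F]

/-- Ball's theorem for lengths that exceed the field size by two, in the range of dimensions that
leaves room for the set `E`. -/
theorem DeterminedByCoordinates.card_ne {C : Submodule F (ι → F)}
    (hC : DeterminedByCoordinates C) (h2 : 2 ≤ Module.finrank F C)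
    (hp : Module.finrank F C ≤ ringChar F) (hk : 2 * Module.finrank F C ≤ Fintype.card F + 5) :
    Fintype.card ι ≠ Fintype.card F + 2 := by
  classical
  intro hι
  obtain ⟨m, hm⟩ : ∃ m, Module.finrank F C = m + 2 := ⟨Module.finrank F C - 2, by lia⟩
  have hprime : (ringChar F).Prime := CharP.char_is_prime F _
  refine not_exists_arc (V := Fin (m + 2) → F) (by simp) hι (by lia) ?_
    Matrix.detRowAlternating _ (hC.det_ne_zero (Module.finBasisOfFinrankEq F C hm))
  rw [Ne, ringChar.spec, hprime.dvd_factorial]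
  lia

/-- Ball's theorem. The dual of a code of length `q + 2` takes care of the large dimensions. -/
theorem DeterminedByCoordinates.card_le {C : Submodule F (ι → F)}
    (hC : DeterminedByCoordinates C) (h2 : 2 ≤ Module.finrank F C)
    (hp : Module.finrank F C ≤ ringChar F) : Fintype.card ι ≤ Fintype.card F + 1 := by
  by_contra hlt
  have hq : ringChar F ≤ Fintype.card F :=
    Nat.le_of_dvd Fintype.card_pos ((ringChar.spec F _).mp (Nat.cast_card_eq_zero F))
  obtain ⟨T, -, hT⟩ := exists_subset_card_eq (s := (univ : Finset ι)) (n := Fintype.card F + 2)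
    (by rw [card_univ]; lia)
  obtain ⟨C', hC'k, hC'⟩ := hC.exists_restrict T (by lia)
  have hTc : Fintype.card T = Fintype.card F + 2 := by rw [Fintype.card_coe, hT]
  by_cases hk : 2 * Module.finrank F C ≤ Fintype.card F + 5
  · exact hC'.card_ne (by lia) (by lia) (by lia) hTc
  · have := finrank_dualCode C'
    exact hC'.dualCode.card_ne (by lia) (by lia) (by lia) hTc

end

section

variable {ι F : Type*} [Fintype ι] [Field F]

theorem IsMDS.monomiallyEquivalent_repetitionCode {C : Submodule F (ι → F)} (hC : IsMDS C)
    (h1 : Module.finrank F C = 1) : MonomiallyEquivalent C (repetitionCode ι F) := by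
  obtain ⟨⟨x, hx⟩, h0, hspan⟩ := finrank_eq_one_iff'.mp h1
  have hne : ∀ i, x i ≠ 0 := fun i hi => by
    refine h0 (Subtype.ext (hC.determinedByCoordinates {i} (by rw [card_singleton, h1]) x hx ?_))
    simpa using hi
  refine ⟨1, fun i => (Units.mk0 (x i) (hne i))⁻¹, fun y => ?_⟩
  rw [repetitionCode, Submodule.mem_span_singleton]
  constructor
  · intro hy
    obtain ⟨c, hc⟩ := hspan ⟨y, hy⟩
    refine ⟨c, funext fun i => ?_⟩
    have : c * x i = y i := congr_fun (congr_arg Subtype.val hc) i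
    simp only [Pi.smul_apply, smul_eq_mul, Units.val_inv_eq_inv_val, Units.val_mk0,
      Equiv.Perm.one_apply, ← this]
    field_simp [hne i]
  · rintro ⟨c, hc⟩
    have : y = c • x := funext fun i => by
      have h := congr_fun hc i
      simp only [Pi.smul_apply, smul_eq_mul, Units.val_inv_eq_inv_val, Units.val_mk0,
        Equiv.Perm.one_apply] at h ⊢
      have := hne i
      field_simp at h
      linear_combination -h
    rw [this]
    exact C.smul_mem c hx

end

section

variable {F G : Type*} [Field F] [Group G] [Fintype G]

theorem finrank_toLinearCode (C : Ideal (MonoidAlgebra F G)) :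
    Module.finrank F (toLinearCode C) = Module.finrank F (C.restrictScalars F) :=
  LinearEquiv.finrank_map_eq _ _

theorem card_le_of_isMDS_of_isECDCode [Fintype F] (C : Ideal (MonoidAlgebra F G))
    (hC : IsMDS (toLinearCode C))
    (hrep : ¬ MonomiallyEquivalent (toLinearCode C) (repetitionCode G F)) (hE : IsECDCode C) :
    Fintype.card G ≤ Fintype.card F + 1 := by
  have h0 : Module.finrank F (toLinearCode C) ≠ 0 := fun h =>
    hC.1 (Submodule.finrank_eq_zero.mp h)
  have h1 : Module.finrank F (toLinearCode C) ≠ 1 := fun h =>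
    hrep (hC.monomiallyEquivalent_repetitionCode h)
  have h2 := hE.2
  rw [← finrank_toLinearCode] at h2
  exact hC.determinedByCoordinates.card_le (by lia) h2

end

/-! ### Reindexing the coordinates of a code -/

section

variable {ι κ F : Type*} [Field F]

/-- The code `C` with its coordinates renamed along the bijection `f`. -/
def reindexCode (f : ι ≃ κ) (C : Submodule F (ι → F)) : Submodule F (κ → F) :=
  C.comap (LinearEquiv.funCongrLeft F F f).toLinearMap

theorem mem_reindexCode (f : ι ≃ κ) (C : Submodule F (ι → F)) (z : κ → F) :
    z ∈ reindexCode f C ↔ z ∘ f ∈ C := Iff.rfl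

theorem finrank_reindexCode (f : ι ≃ κ) (C : Submodule F (ι → F)) :
    Module.finrank F (reindexCode f C) = Module.finrank F C := by
  rw [reindexCode, Submodule.comap_equiv_eq_map_symm]
  exact LinearEquiv.finrank_map_eq _ _

theorem reindexCode_repetitionCode (f : ι ≃ κ) :
    reindexCode f (repetitionCode ι F) = repetitionCode κ F := by
  ext z
  rw [mem_reindexCode, repetitionCode, repetitionCode, Submodule.mem_span_singleton,
    Submodule.mem_span_singleton]
  refine exists_congr fun c => ⟨fun h => funext fun j => ?_, fun h => funext fun i => ?_⟩
  · simpa using congr_fun h (f.symm j)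
  · simpa using congr_fun h (f i)

theorem MonomiallyEquivalent.of_reindexCode {f : ι ≃ κ} {C D : Submodule F (ι → F)}
    (h : MonomiallyEquivalent (reindexCode f C) (reindexCode f D)) :
    MonomiallyEquivalent C D := by
  obtain ⟨σ, a, h⟩ := h
  refine ⟨(f.trans σ).trans f.symm, fun i => a (f i), fun x => ?_⟩
  have := h (x ∘ f.symm)
  rw [mem_reindexCode, Function.comp_assoc, Equiv.symm_comp_self, Function.comp_id] at this
  exact this

variable [Fintype ι] [Fintype κ]

theorem hammingNorm_comp_equiv [DecidableEq F] (f : ι ≃ κ) (z : κ → F) :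
    hammingNorm (z ∘ f) = hammingNorm z := by
  unfold hammingNorm
  refine card_bij' (fun i _ => f i) (fun j _ => f.symm j) ?_ ?_ ?_ ?_ <;> simp

theorem minDist_reindexCode (f : ι ≃ κ) (C : Submodule F (ι → F)) :
    minDist (reindexCode f C) = minDist C := by
  classical
  rw [minDist_eq_minWeight, minDist_eq_minWeight]
  congr 1
  ext w
  constructor
  · rintro ⟨z, hz, h0, rfl⟩
    refine ⟨z ∘ f, hz, fun h => h0 ?_, by convert hammingNorm_comp_equiv f z⟩
    funext j
    simpa using congr_fun h (f.symm j)
  · rintro ⟨x, hx, h0, rfl⟩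
    refine ⟨x ∘ f.symm, ?_, fun h => h0 ?_, by convert hammingNorm_comp_equiv f.symm x⟩
    · rw [mem_reindexCode, Function.comp_assoc, Equiv.symm_comp_self, Function.comp_id]
      exact hx
    · funext i
      simpa using congr_fun h (f i)

theorem mem_dualCode_repetitionCode (x : ι → F) :
    x ∈ dualCode (repetitionCode ι F) ↔ ∑ i, x i = 0 := by
  constructor
  · intro h
    simpa [dotProduct] using h (fun _ => 1) (Submodule.mem_span_singleton_self _)
  · intro h y hy
    obtain ⟨c, rfl⟩ := Submodule.mem_span_singleton.mp hy
    simp [dotProduct, ← Finset.sum_mul, h]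

theorem reindexCode_dualCode_repetitionCode (f : ι ≃ κ) :
    reindexCode f (dualCode (repetitionCode ι F)) = dualCode (repetitionCode κ F) := by
  ext z
  rw [mem_reindexCode, mem_dualCode_repetitionCode, mem_dualCode_repetitionCode,
    ← Equiv.sum_comp f z]
  rfl

theorem IsNontrivialMDS.reindexCode (f : ι ≃ κ) {C : Submodule F (ι → F)}
    (hC : IsNontrivialMDS C) : IsNontrivialMDS (reindexCode f C) := by
  obtain ⟨⟨hbot, hcard⟩, htriv⟩ := hC
  refine ⟨⟨fun h => hbot ?_, ?_⟩, fun h => htriv ?_⟩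
  · rw [← Submodule.finrank_eq_zero (R := F), ← finrank_reindexCode f, h, finrank_bot]
  · rw [finrank_reindexCode, minDist_reindexCode, hcard, Fintype.card_congr f]
  · rcases h with h | h | h
    · left
      rw [eq_top_iff]
      intro x _
      have hx : x ∘ f.symm ∈ GroupCode.reindexCode f C := by rw [h]; trivial
      rwa [mem_reindexCode, Function.comp_assoc, Equiv.symm_comp_self, Function.comp_id] at hx
    · rw [← reindexCode_repetitionCode f] at h
      exact Or.inr (Or.inl h.of_reindexCode)
    · rw [← reindexCode_dualCode_repetitionCode f] at h
      exact Or.inr (Or.inr h.of_reindexCode)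

end

/-! ### Group algebras over prime fields -/

section

/-- The conjecture concerns codes with coordinates indexed by `Fin n`, hence the reindexing. -/
theorem card_le_of_mdsConjecture {ι : Type*} [Fintype ι] {p : ℕ} [Fact p.Prime] (hp : p ≠ 2)
    (hMDS : MDSConjecture)
    {C : Submodule (ZMod p) (ι → ZMod p)} (hC : IsNontrivialMDS C) : Fintype.card ι ≤ p + 1 := by
  have h := (hMDS (ZMod p) (Fintype.card ι) _
    ⟨_, rfl, hC.reindexCode (Fintype.equivFin ι)⟩).2
  rw [ZMod.card] at h
  refine h fun h' => ?_
  exact Nat.not_even_iff_odd.mpr ((Fact.out : p.Prime).odd_of_ne_two hp) h'.1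

variable {G : Type*} [Group G] [Fintype G]

theorem isECDGroupAlgebra_of_card_le {p : ℕ} [Fact p.Prime] (hcard : Fintype.card G ≤ p + 1)
    (hdvd : ¬ p ∣ Fintype.card G) : IsECDGroupAlgebra (ZMod p) G := by
  have : NeZero (Nat.card G : ZMod p) := ⟨by
    rwa [Nat.card_eq_fintype_card, Ne, ZMod.natCast_eq_zero_iff]⟩
  intro J _ hJ
  refine ⟨IsSemisimpleRing.ideal_eq_span_idempotent J, ?_⟩
  let e := (MonoidAlgebra.coeffLinearEquiv (ZMod p)).trans
    (Finsupp.linearEquivFunOnFinite (ZMod p) (ZMod p) G)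
  have : Module.Finite (ZMod p) (MonoidAlgebra (ZMod p) G) := Module.Finite.equiv e.symm
  have hlt : Module.finrank (ZMod p) (J.restrictScalars (ZMod p)) <
      Module.finrank (ZMod p) (MonoidAlgebra (ZMod p) G) := by
    refine Submodule.finrank_lt fun h => hJ ?_
    rw [Submodule.restrictScalars_eq_top_iff] at h
    exact h
  rw [e.finrank_eq, Module.finrank_fintype_fun_eq_card] at hlt
  rw [ZMod.ringChar_zmod_n]
  lia

theorem not_dvd_card_of_card_le {p : ℕ} [Fact p.Prime] (hcard : Fintype.card G ≤ p + 1)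
    (hG : ¬ Nonempty (G ≃* Multiplicative (ZMod p))) : ¬ p ∣ Fintype.card G := by
  rintro ⟨c, hc⟩
  have h2 := (Fact.out : p.Prime).two_le
  have hpos : 0 < Fintype.card G := Fintype.card_pos
  have hc1 : c = 1 := by
    rcases c with _ | _ | c
    · lia
    · rfl
    · nlinarith
  refine hG ⟨mulEquivOfPrimeCardEq (p := p) ?_ ?_⟩
  · rw [Nat.card_eq_fintype_card, hc, hc1, mul_one]
  · simp

end
end GroupCode

theorem mainTheorem8 :
    (∀ (F : Type*) [Field F] [Fintype F] (G : Type*) [Group G] [Fintype G]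
        (C : Ideal (MonoidAlgebra F G)),
        GroupCode.IsMDS (GroupCode.toLinearCode C) →
        ¬ GroupCode.MonomiallyEquivalent (GroupCode.toLinearCode C)
          (GroupCode.repetitionCode G F) →
        GroupCode.IsECDCode C →
        Fintype.card G ≤ Fintype.card F + 1) ∧
    (∀ (p : ℕ) [Fact p.Prime], p ≠ 2 →
        GroupCode.MDSConjecture →
        ∀ (G : Type*) [Group G] [Fintype G],
        ¬ Nonempty (G ≃* Multiplicative (ZMod p)) →
        (∃ C : Ideal (MonoidAlgebra (ZMod p) G),
          GroupCode.IsNontrivialMDS (GroupCode.toLinearCode C)) →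
        GroupCode.IsECDGroupAlgebra (ZMod p) G) := by
  refine ⟨fun F _ _ G _ _ C hC hrep hE => GroupCode.card_le_of_isMDS_of_isECDCode C hC hrep hE,
    fun p _ hp hMDS G _ _ hG hC => ?_⟩
  obtain ⟨C, hC⟩ := hC
  have hcard := GroupCode.card_le_of_mdsConjecture hp hMDS hC
  exact GroupCode.isECDGroupAlgebra_of_card_le hcard
    (GroupCode.not_dvd_card_of_card_le hcard hG)
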